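/- Let $\Phi\in\mathbb{R}^{m\times n}$ have columns (atoms) $\phi_1,\dots,\phi_n$ with $\|\phi_j\|_2=1$ for all $j$. Let $X=(x_1,\dots,x_K)\in\mathbb{R}^{n\times K}$, and let $S=\bigcup_{k}\operatorname{supp}(x_k)\subseteq\{1,\dots,n\}$ be its joint support, with $S\neq\emptyset$ and $\overline{S}:=\{1,\dots,n\}\setminus S\neq\emptyset$; atoms indexed by $S$ are called correct, the others incorrect. Let $\sigma=(\sigma_1,\dots,\sigma_K)\neq 0$ with all $\sigma_k\ge 0$, let $e_k\sim\mathcal{N}(0,\sigma_k^2 I_m)$, $1\le k\le K$, be mutually independent, and let $Y=\Phi X+(e_1,\dots,e_K)$. Fix $t\ge 0$, a set $T\subseteq S$ with $|T|=t$, and let $P$ be the orthogonal projector of $\mathbb{R}^m$ onto $\operatorname{span}\{\phi_j: j\in T\}$ (so $P=0$ for $t=0$). For each $j$ and $k$ put $$\beta_{j,k}:=|\langle\phi_j,(I-P)\Phi x_k\rangle|,\qquad \sigma_{j,k}:=\|(I-P)\phi_j\|_2\,\sigma_k,\qquad f_j(g):=\sum_{k=1}^K|\beta_{j,k}+\sigma_{j,k}g_k|\quad(g\in\mathbb{R}^K),$$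 let $j_c\in\operatorname{argmax}_{j\in S}\sum_{k=1}^K\beta_{j,k}$, and, for $g\sim\mathcal{N}(0,I_K)$, let $$\Delta E:=\mathbb{E}[f_{j_c}(g)]-\max_{j\in\overline{S}}\mathbb{E}[f_j(g)].$$ One iteration of SOMP (simultaneous orthogonal matching pursuit) on a matrix $R=(r_1,\dots,r_K)\in\mathbb{R}^{m\times K}$ picks an index $j\in\{1,\dots,n\}$ maximizing $\|R^{\mathrm T}\phi_j\|_1=\sum_{k=1}^K|\langle\phi_j,r_k\rangle|$, ties being broken in an arbitrary way. If $\Delta E>0$, then the probability that one iteration of SOMP on $R=(I-P)Y$ picks an incorrect atom is at most $$(n-|S|+1)\exp\left(-\frac{(\Delta E)^2}{8\|\sigma\|_2^2}\right).$$ -/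

import Mathlib

open MeasureTheory ProbabilityTheory

noncomputable section

namespace SOMP

variable {m n K : ℕ}

/-- The `j`-th atom, i.e. the `j`-th column of the measurement matrix `Φ`, as a Euclidean vector. -/
def atom (Φ : Matrix (Fin m) (Fin n) ℝ) (j : Fin n) : EuclideanSpace ℝ (Fin m) :=
  WithLp.toLp 2 (fun i => Φ i j)

open Classical in
/-- The joint support of the sparse signals (the columns of `X`): the union of their supports. -/
def jointSupport (X : Matrix (Fin n) (Fin K) ℝ) : Finset (Fin n) :=
  Finset.univ.filter (fun j => ∃ k, X j k ≠ 0)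

/-- The noiseless measurement `Φ x_k` of the `k`-th sparse signal. -/
def cleanMeasurement (Φ : Matrix (Fin m) (Fin n) ℝ) (X : Matrix (Fin n) (Fin K) ℝ) (k : Fin K) :
    EuclideanSpace ℝ (Fin m) :=
  WithLp.toLp 2 (Φ.mulVec (fun j => X j k))

/-- The orthogonal projector onto the span of the atoms indexed by `T`
(in matrix notation `Φ_T Φ_T⁺`). -/
def projector (Φ : Matrix (Fin m) (Fin n) ℝ) (T : Finset (Fin n)) :
    EuclideanSpace ℝ (Fin m) →L[ℝ] EuclideanSpace ℝ (Fin m) :=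
  (Submodule.span ℝ (atom Φ '' (T : Set (Fin n)))).starProjection

/-- The possible projectors at iteration `t` when only atoms indexed by `S` have been picked. -/
def projectors (Φ : Matrix (Fin m) (Fin n) ℝ) (S : Finset (Fin n)) (t : ℕ) :
    Set (EuclideanSpace ℝ (Fin m) →L[ℝ] EuclideanSpace ℝ (Fin m)) :=
  {P | ∃ T : Finset (Fin n), T ⊆ S ∧ T.card = t ∧ P = projector Φ T}

/-- The residual matrix `R = (I - P) Y`, given by its columns, for a matrix `Y` given by its
columns. -/
def residual (P : EuclideanSpace ℝ (Fin m) →L[ℝ] EuclideanSpace ℝ (Fin m))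
    (Y : Fin K → EuclideanSpace ℝ (Fin m)) : Fin K → EuclideanSpace ℝ (Fin m) :=
  fun k => Y k - P (Y k)

/-- The SOMP metric `‖Rᵀ φ_j‖₁ = ∑ₖ |⟨φ_j, r_k⟩|` of the `j`-th atom. -/
def metric (Φ : Matrix (Fin m) (Fin n) ℝ) (R : Fin K → EuclideanSpace ℝ (Fin m)) (j : Fin n) : ℝ :=
  ∑ k, |inner ℝ (atom Φ j) (R k)|

/-- One SOMP iteration on the residual `R` may pick atom `j`: its metric is maximal over
all the atoms. -/
def Picks (Φ : Matrix (Fin m) (Fin n) ℝ) (R : Fin K → EuclideanSpace ℝ (Fin m)) (j : Fin n) :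
    Prop :=
  ∀ i : Fin n, metric Φ R i ≤ metric Φ R j

/-- `β_{j,k} = |⟨φ_j, (I - P) Φ x_k⟩|`. -/
def beta (Φ : Matrix (Fin m) (Fin n) ℝ) (X : Matrix (Fin n) (Fin K) ℝ)
    (P : EuclideanSpace ℝ (Fin m) →L[ℝ] EuclideanSpace ℝ (Fin m)) (j : Fin n) (k : Fin K) : ℝ :=
  |inner ℝ (atom Φ j) (cleanMeasurement Φ X k - P (cleanMeasurement Φ X k))|

/-- `jc` is a best correct atom in the noiseless case: `jc ∈ argmax_{j ∈ S} ∑ₖ β_{j,k}`, where `S`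
is the joint support. -/
def IsBestCorrectAtom (Φ : Matrix (Fin m) (Fin n) ℝ) (X : Matrix (Fin n) (Fin K) ℝ)
    (P : EuclideanSpace ℝ (Fin m) →L[ℝ] EuclideanSpace ℝ (Fin m)) (jc : Fin n) : Prop :=
  jc ∈ jointSupport X ∧ ∀ j ∈ jointSupport X, ∑ k, beta Φ X P j k ≤ ∑ k, beta Φ X P jc k

/-- `σ_{j,k} = ‖(I - P) φ_j‖₂ σ_k`. -/
def atomSigma (Φ : Matrix (Fin m) (Fin n) ℝ) (σ : EuclideanSpace ℝ (Fin K))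
    (P : EuclideanSpace ℝ (Fin m) →L[ℝ] EuclideanSpace ℝ (Fin m)) (j : Fin n) (k : Fin K) : ℝ :=
  ‖atom Φ j - P (atom Φ j)‖ * σ k

/-- `f_j(g) = ∑ₖ |β_{j,k} + σ_{j,k} g_k|`. -/
def f (Φ : Matrix (Fin m) (Fin n) ℝ) (X : Matrix (Fin n) (Fin K) ℝ) (σ : EuclideanSpace ℝ (Fin K))
    (P : EuclideanSpace ℝ (Fin m) →L[ℝ] EuclideanSpace ℝ (Fin m)) (j : Fin n)
    (g : EuclideanSpace ℝ (Fin K)) : ℝ :=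
  ∑ k, |beta Φ X P j k + atomSigma Φ σ P j k * g k|

/-- `𝔼[f_j(g)]` for `g ∼ N(0, I)` on `ℝ^K`. -/
def expectedMetric (Φ : Matrix (Fin m) (Fin n) ℝ) (X : Matrix (Fin n) (Fin K) ℝ)
    (σ : EuclideanSpace ℝ (Fin K))
    (P : EuclideanSpace ℝ (Fin m) →L[ℝ] EuclideanSpace ℝ (Fin m)) (j : Fin n) : ℝ :=
  ∫ g, f Φ X σ P j g ∂(stdGaussian (EuclideanSpace ℝ (Fin K)))

/-- `ΔE = 𝔼[f_{jc}(g)] - max_{j ∉ S} 𝔼[f_j(g)]`, where `S` is the joint support. -/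
def deltaE (Φ : Matrix (Fin m) (Fin n) ℝ) (X : Matrix (Fin n) (Fin K) ℝ)
    (σ : EuclideanSpace ℝ (Fin K))
    (P : EuclideanSpace ℝ (Fin m) →L[ℝ] EuclideanSpace ℝ (Fin m)) (jc : Fin n)
    (hS : (jointSupport X)ᶜ.Nonempty) : ℝ :=
  expectedMetric Φ X σ P jc - (jointSupport X)ᶜ.sup' hS (expectedMetric Φ X σ P)

end SOMP

end

/-!
If the pick `j` is incorrect, then its metric is at least that of `jc`, whereas `𝔼[f_j]` is at least
`ΔE` below `𝔼[f_{jc}]`. Hence some incorrect atom has a metric exceeding its mean by `ΔE / 2`, or the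
metric of `jc` falls short of its mean by `ΔE / 2`: at most `n - |S| + 1` events. Each of them has
probability at most `exp (-(ΔE / 2)² / (2 ‖σ‖²))`, because each metric, once centred, is
sub-Gaussian with variance proxy `‖σ‖²` (`SOMP.hasSubgaussianMGF_metric_residual`).

The metric of `φ_j` is a sum of independent variables `|Z_k|` with `Z_k` a real Gaussian of variance
`σ_{j,k}² ≤ σ_k²`, so general Gaussian concentration of Lipschitz functions is not needed: it is
enough that `|Z| - 𝔼|Z|` is sub-Gaussian with variance proxy `v` for `Z ∼ N(b, v)`
(`hasSubgaussianMGF_abs_sub_integral_gaussianReal`). For this, let `ψ` be the moment generating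
function of `|Z|` and `M = 𝔼|Z|`. Gaussian integration by parts applied to the `C¹` function
`H x = sign x * (exp (t |x|) - 1)` gives
`(M + v t) ψ(t) - ψ'(t) = 𝔼[M (exp (t |Z|) - 1) - b H(Z)]`.
Since `|b| ≤ M` and `|H x| = |exp (t |x|) - 1|`, the right side is nonnegative for `t ≥ 0` and
nonpositive for `t ≤ 0`; so `ψ(t) exp (-(t M + v t² / 2))` is maximal at `t = 0`, where
it is `1`.
-/

/-! ### Gaussian integration by parts -/

/-- The function `sign x * (exp (l |x|) - 1)` is differentiable also at `0`. -/
lemma hasDerivAt_ite_exp_sub_one (l x : ℝ) :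
    HasDerivAt (fun x : ℝ ↦ if 0 ≤ x then Real.exp (l * x) - 1 else 1 - Real.exp (-(l * x)))
      (l * Real.exp (l * |x|)) x := by
  have h1 : HasDerivAt (fun x : ℝ ↦ Real.exp (l * x) - 1) (l * Real.exp (l * x)) x := by
    have := ((hasDerivAt_id x).const_mul l).exp.sub_const 1
    simpa [mul_comm] using this
  have h2 : HasDerivAt (fun x : ℝ ↦ 1 - Real.exp (-(l * x))) (l * Real.exp (-(l * x))) x := by
    have := (((hasDerivAt_id x).const_mul l).neg).exp.const_sub 1
    simpa [mul_comm] using this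
  rcases lt_trichotomy x 0 with hx | rfl | hx
  · rw [abs_of_neg hx, mul_neg]
    refine h2.congr_of_eventuallyEq ?_
    filter_upwards [Iio_mem_nhds hx] with y hy
    rw [if_neg (not_le.mpr hy)]
  · rw [← hasDerivWithinAt_univ, ← Set.Iic_union_Ici (a := (0 : ℝ))]
    refine HasDerivWithinAt.union ?_ ?_
    · have h := h2.hasDerivWithinAt (s := Set.Iic 0)
      simp only [mul_zero, neg_zero, abs_zero] at h ⊢
      refine h.congr (fun y hy ↦ ?_) (by simp)
      rcases (show y ≤ 0 from hy).eq_or_lt with rfl | hy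
      · simp
      · rw [if_neg (not_le.mpr hy)]
    · have h := h1.hasDerivWithinAt (s := Set.Ici 0)
      simp only [mul_zero, abs_zero] at h ⊢
      exact h.congr (fun y hy ↦ if_pos hy) (by simp)
  · rw [abs_of_pos hx]
    refine h1.congr_of_eventuallyEq ?_
    filter_upwards [Ioi_mem_nhds hx] with y hy
    rw [if_pos (le_of_lt hy)]

lemma integrable_gaussianReal_iff {b : ℝ} {v : NNReal} (hv : v ≠ 0) {f : ℝ → ℝ} :
    Integrable f (gaussianReal b v) ↔ Integrable (fun x ↦ gaussianPDFReal b v x * f x) := by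
  rw [gaussianReal_of_var_ne_zero _ hv, integrable_withDensity_iff_integrable_smul₀'
    (by fun_prop) (ae_of_all _ fun _ ↦ gaussianPDF_lt_top)]
  simp [smul_eq_mul]

/-- Stein's identity for the Gaussian law `N(b, v)`. -/
lemma integral_sub_mul_gaussianReal {b : ℝ} {v : NNReal} (hv : v ≠ 0) {f f' : ℝ → ℝ}
    (hf : ∀ x, HasDerivAt f (f' x) x) (hfi : Integrable f (gaussianReal b v))
    (hxf : Integrable (fun x ↦ (x - b) * f x) (gaussianReal b v))
    (hf' : Integrable f' (gaussianReal b v)) :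
    ∫ x, (x - b) * f x ∂(gaussianReal b v) = v * ∫ x, f' x ∂(gaussianReal b v) := by
  have hv' : (v : ℝ) ≠ 0 := by exact_mod_cast hv
  have hp (x : ℝ) : HasDerivAt (gaussianPDFReal b v)
      (-(x - b) / v * gaussianPDFReal b v x) x := by
    rw [gaussianPDFReal_def]
    refine (((((hasDerivAt_id' x).sub_const b).fun_pow 2).fun_neg.div_const
      (2 * (v : ℝ))).exp.const_mul (√(2 * Real.pi * v))⁻¹).congr_deriv ?_
    field_simp
    simp
  -- The derivative of `p * f`, for the density `p`, integrates to zero.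
  have h := integral_eq_zero_of_hasDerivAt_of_integrable (f := fun x ↦ gaussianPDFReal b v x * f x)
    (f' := fun x ↦ gaussianPDFReal b v x * (f' x - (v : ℝ)⁻¹ * ((x - b) * f x)))
    (fun x ↦ ((hp x).mul (hf x)).congr_deriv (by field_simp; ring))
    ((integrable_gaussianReal_iff hv).1 (hf'.sub (hxf.const_mul _)))
    ((integrable_gaussianReal_iff hv).1 hfi)
  have h2 : ∫ x, (f' x - (v : ℝ)⁻¹ * ((x - b) * f x)) ∂(gaussianReal b v) = 0 := by
    rw [integral_gaussianReal_eq_integral_smul hv]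
    exact h
  rw [integral_sub hf' (hxf.const_mul _), integral_const_mul] at h2
  field_simp at h2
  linarith

/-! ### The absolute value of a real Gaussian is sub-Gaussian -/

lemma integrable_exp_mul_abs_gaussianReal (b : ℝ) (v : NNReal) (t : ℝ) :
    Integrable (fun x ↦ Real.exp (t * |x|)) (gaussianReal b v) :=
  integrable_exp_mul_abs (integrable_exp_mul_gaussianReal t) (integrable_exp_mul_gaussianReal (-t))

lemma integrableExpSet_abs_gaussianReal (b : ℝ) (v : NNReal) :
    integrableExpSet (fun x ↦ |x|) (gaussianReal b v) = Set.univ :=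
  Set.eq_univ_of_forall (integrable_exp_mul_abs_gaussianReal b v)

lemma abs_mean_le_integral_abs_gaussianReal (b : ℝ) (v : NNReal) :
    |b| ≤ ∫ x, |x| ∂(gaussianReal b v) := by
  simpa using abs_integral_le_integral_abs (f := fun x ↦ x) (μ := gaussianReal b v)

/-- The derivative of the moment generating function of `|Z|`, `Z ∼ N(b, v)`, by Stein's identity for
`H x = sign x * (exp (t |x|) - 1)`. Of `H`, only its absolute value matters afterwards. -/
lemma exists_integral_abs_mul_exp_gaussianReal_eq (b : ℝ) {v : NNReal} (hv : v ≠ 0) (t : ℝ) :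
    ∃ H : ℝ → ℝ, Integrable H (gaussianReal b v) ∧ (∀ x, |H x| = |Real.exp (t * |x|) - 1|) ∧
      ∫ x, |x| * Real.exp (t * |x|) ∂(gaussianReal b v) =
        ∫ x, |x| ∂(gaussianReal b v) + b * ∫ x, H x ∂(gaussianReal b v) +
          v * t * mgf (fun x ↦ |x|) (gaussianReal b v) t := by
  set γ := gaussianReal b v
  set H : ℝ → ℝ := fun x ↦ if 0 ≤ x then Real.exp (t * x) - 1 else 1 - Real.exp (-(t * x)) with hH
  have hmem : t ∈ interior (integrableExpSet (fun x ↦ |x|) γ) := by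
    simp [γ, integrableExpSet_abs_gaussianReal]
  have hE : Integrable (fun x ↦ Real.exp (t * |x|)) γ :=
    integrable_exp_mul_abs_gaussianReal b v t
  have hXE : Integrable (fun x ↦ |x| * Real.exp (t * |x|)) γ := by
    simpa using integrable_pow_abs_mul_exp_of_mem_interior_integrableExpSet hmem 1
  have hX : Integrable (fun x ↦ |x|) γ := (IsGaussian.integrable_fun_id (μ := γ)).abs
  have hHd (x : ℝ) : HasDerivAt H (t * Real.exp (t * |x|)) x := hasDerivAt_ite_exp_sub_one t x
  have hHc : Continuous H := continuous_iff_continuousAt.2 fun x ↦ (hHd x).continuousAt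
  have hHabs (x : ℝ) : |H x| = |Real.exp (t * |x|) - 1| := by
    rcases le_or_gt 0 x with hx | hx
    · simp [hH, hx, abs_of_nonneg hx]
    · simp only [hH, if_neg (not_le.2 hx), abs_of_neg hx, mul_neg]
      rw [abs_sub_comm]
  have hxH (x : ℝ) : x * H x = |x| * Real.exp (t * |x|) - |x| := by
    rcases le_or_gt 0 x with hx | hx
    · simp only [hH, if_pos hx, abs_of_nonneg hx]
      ring
    · simp only [hH, if_neg (not_le.2 hx), abs_of_neg hx, mul_neg]
      ring
  have hHi : Integrable H γ :=
    (hE.sub (integrable_const 1)).mono hHc.aestronglyMeasurable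
      (ae_of_all _ fun x ↦ by simpa using (hHabs x).le)
  have hxHi : Integrable (fun x ↦ (x - b) * H x) γ := by
    simp_rw [sub_mul, hxH]
    exact (hXE.sub hX).sub (hHi.const_mul b)
  refine ⟨H, hHi, hHabs, ?_⟩
  have h := integral_sub_mul_gaussianReal hv hHd hHi hxHi (hE.const_mul t)
  simp_rw [sub_mul, hxH] at h
  rw [integral_sub (f := fun x ↦ |x| * Real.exp (t * |x|) - |x|) (hXE.sub hX) (hHi.const_mul b),
    integral_sub hXE hX, integral_const_mul, integral_const_mul] at h
  rw [mgf]
  linarith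

lemma mgf_abs_gaussianReal_le (b : ℝ) {v : NNReal} (hv : v ≠ 0) (t : ℝ) :
    mgf (fun x ↦ |x|) (gaussianReal b v) t ≤
      Real.exp (t * (∫ x, |x| ∂(gaussianReal b v)) + v * t ^ 2 / 2) := by
  set γ := gaussianReal b v
  set M := ∫ x, |x| ∂γ with hM
  set ψ := mgf (fun x ↦ |x|) γ with hψ
  have hmem (t : ℝ) : t ∈ interior (integrableExpSet (fun x ↦ |x|) γ) := by
    simp [γ, integrableExpSet_abs_gaussianReal]
  have hbM : |b| ≤ M := abs_mean_le_integral_abs_gaussianReal b v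
  set ψ' : ℝ → ℝ := fun t ↦ ∫ x, |x| * Real.exp (t * |x|) ∂γ with hψ'
  -- `G` is shown to increase up to `0` and to decrease from there on, and `G 0 = 1`.
  set G : ℝ → ℝ := fun t ↦ ψ t * Real.exp (-(t * M + v * t ^ 2 / 2)) with hG
  have hGd (t : ℝ) : HasDerivAt G
      ((ψ' t - (M + v * t) * ψ t) * Real.exp (-(t * M + v * t ^ 2 / 2))) t := by
    have h1 : HasDerivAt ψ (ψ' t) t := hasDerivAt_mgf (hmem t)
    have h2 : HasDerivAt (fun t : ℝ ↦ -(t * M + v * t ^ 2 / 2)) (-(M + v * t)) t := by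
      refine ((((hasDerivAt_id' t).mul_const M).fun_add
        ((((hasDerivAt_id' t).fun_pow 2).const_mul (v : ℝ)).div_const 2)).fun_neg).congr_deriv ?_
      simp
      ring
    exact (h1.mul h2.exp).congr_deriv (by ring)
  have hsign (t : ℝ) : (0 ≤ t → ψ' t - (M + v * t) * ψ t ≤ 0) ∧
      (t ≤ 0 → 0 ≤ ψ' t - (M + v * t) * ψ t) := by
    obtain ⟨H, hHi, hHabs, h⟩ := exists_integral_abs_mul_exp_gaussianReal_eq b hv t
    have hE : Integrable (fun x ↦ Real.exp (t * |x|)) γ :=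
      integrable_exp_mul_abs_gaussianReal b v t
    have hD : ψ' t - (M + v * t) * ψ t =
        -∫ x, (M * (Real.exp (t * |x|) - 1) - b * H x) ∂γ := by
      rw [integral_sub (f := fun x ↦ M * (Real.exp (t * |x|) - 1))
          ((hE.sub (integrable_const 1)).const_mul M) (hHi.const_mul b),
        integral_const_mul, integral_const_mul, integral_sub hE (integrable_const 1)]
      simp only [hψ', hψ, integral_const, probReal_univ, smul_eq_mul, mul_one]
      rw [h, mgf]
      ring
    have hbH (x : ℝ) : |b * H x| ≤ M * |Real.exp (t * |x|) - 1| := by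
      rw [abs_mul, hHabs]
      gcongr
    rw [hD]
    refine ⟨fun ht ↦ ?_, fun ht ↦ ?_⟩
    · rw [neg_nonpos]
      refine integral_nonneg fun x ↦ ?_
      have h1 : 0 ≤ Real.exp (t * |x|) - 1 :=
        sub_nonneg.2 (Real.one_le_exp (mul_nonneg ht (abs_nonneg x)))
      have h2 := hbH x
      rw [abs_of_nonneg h1] at h2
      simpa using (le_abs_self _).trans h2
    · rw [neg_nonneg]
      refine integral_nonpos fun x ↦ ?_
      have h1 : Real.exp (t * |x|) - 1 ≤ 0 :=
        sub_nonpos.2 (Real.exp_le_one_iff.2 (mul_nonpos_of_nonpos_of_nonneg ht (abs_nonneg x)))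
      have h2 := hbH x
      rw [abs_of_nonpos h1] at h2
      have h3 := (neg_abs_le (b * H x))
      simp only [Pi.zero_apply]
      linarith
  have hGc : Continuous G := continuous_iff_continuousAt.2 fun t ↦ (hGd t).continuousAt
  have hG0 : G 0 = 1 := by simp [hG, hψ]
  have hG1 : G t ≤ 1 := by
    rw [← hG0]
    rcases le_total 0 t with ht | ht
    · refine antitoneOn_of_deriv_nonpos (convex_Ici 0) hGc.continuousOn
        (fun x _ ↦ (hGd x).differentiableAt.differentiableWithinAt) (fun x hx ↦ ?_)
        Set.self_mem_Ici ht ht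
      rw [(hGd x).deriv]
      exact mul_nonpos_of_nonpos_of_nonneg
        ((hsign x).1 (interior_subset (s := Set.Ici (0 : ℝ)) hx)) (Real.exp_nonneg _)
    · refine monotoneOn_of_deriv_nonneg (convex_Iic 0) hGc.continuousOn
        (fun x _ ↦ (hGd x).differentiableAt.differentiableWithinAt) (fun x hx ↦ ?_)
        ht Set.self_mem_Iic ht
      rw [(hGd x).deriv]
      exact mul_nonneg ((hsign x).2 (interior_subset (s := Set.Iic (0 : ℝ)) hx)) (Real.exp_nonneg _)
  simp only [hG] at hG1
  rwa [Real.exp_neg, ← div_eq_mul_inv, div_le_one (Real.exp_pos _)] at hG1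

/-- The variance proxy of `|Z| - 𝔼|Z|` is the variance of `Z ∼ N(b, v)`. The case `v = 0`, where the law
is a Dirac mass without density, is separate. -/
theorem hasSubgaussianMGF_abs_sub_integral_gaussianReal (b : ℝ) (v : NNReal) :
    HasSubgaussianMGF (fun x ↦ |x| - ∫ y, |y| ∂(gaussianReal b v)) v (gaussianReal b v) := by
  rcases eq_or_ne v 0 with rfl | hv
  · simp only [gaussianReal_zero_var, integral_dirac]
    refine HasSubgaussianMGF.zero.congr ?_
    simp [Filter.EventuallyEq, ae_dirac_eq]
  refine ⟨fun t ↦ ?_, fun t ↦ ?_⟩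
  · have h : t ∈ integrableExpSet (fun x ↦ |x|) (gaussianReal b v) := by
      simp [integrableExpSet_abs_gaussianReal]
    simp_rw [mul_sub, Real.exp_sub]
    exact Integrable.div_const h _
  · simp_rw [sub_eq_add_neg]
    rw [mgf_add_const]
    refine (mul_le_mul_of_nonneg_right (mgf_abs_gaussianReal_le b hv t)
      (Real.exp_nonneg _)).trans_eq ?_
    rw [← Real.exp_add]
    congr 1
    ring

lemma hasSubgaussianMGF_mono {Ω : Type*} [MeasurableSpace Ω] {μ : Measure Ω} {Z : Ω → ℝ}
    {c c' : NNReal} (h : HasSubgaussianMGF Z c μ) (hc : c ≤ c') : HasSubgaussianMGF Z c' μ :=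
  ⟨h.integrable_exp_mul, fun t ↦ (h.mgf_le t).trans (by gcongr)⟩

lemma hasSubgaussianMGF_abs_sub_integral {Ω : Type*} [MeasurableSpace Ω] {μ : Measure Ω}
    {Z : Ω → ℝ} {b : ℝ} {v : NNReal} (hZ : HasLaw Z (gaussianReal b v) μ) :
    HasSubgaussianMGF (fun ω ↦ |Z ω| - ∫ x, |x| ∂(gaussianReal b v)) v μ :=
  HasSubgaussianMGF.of_map (X := fun x ↦ |x| - ∫ x, |x| ∂(gaussianReal b v)) hZ.aemeasurable
    (by rw [hZ.map_eq]; exact hasSubgaussianMGF_abs_sub_integral_gaussianReal b v)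

/-- `𝔼|Z|` for `Z ∼ N(b, v)` does not depend on the sign of `b`; this allows for the absolute value in
the definition of `β_{j,k}`. -/
lemma integral_abs_gaussianReal_abs (b : ℝ) (v : NNReal) :
    ∫ x, |x| ∂(gaussianReal |b| v) = ∫ x, |x| ∂(gaussianReal b v) := by
  rcases abs_choice b with h | h
  · rw [h]
  · rw [h, ← gaussianReal_map_neg, integral_map (by fun_prop) (by fun_prop)]
    simp

/-! ### Laws of linear functionals of the noise -/

lemma hasLaw_inner_multivariateGaussian {m : ℕ} {Ω : Type*} [MeasurableSpace Ω] {μ : Measure Ω}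
    {Z : Ω → EuclideanSpace ℝ (Fin m)} {s : ℝ}
    (hZ : HasLaw Z (multivariateGaussian 0 (s ^ 2 • (1 : Matrix (Fin m) (Fin m) ℝ))) μ)
    (w : EuclideanSpace ℝ (Fin m)) :
    HasLaw (fun ω ↦ inner ℝ w (Z ω)) (gaussianReal 0 ((‖w‖ * s) ^ 2).toNNReal) μ := by
  have hpos : (s ^ 2 • (1 : Matrix (Fin m) (Fin m) ℝ)).PosSemidef :=
    Matrix.PosSemidef.one.smul (sq_nonneg s)
  set γ := multivariateGaussian 0 (s ^ 2 • (1 : Matrix (Fin m) (Fin m) ℝ)) with hγ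
  have hmean : γ[innerSL ℝ w] = 0 := by
    rw [ContinuousLinearMap.integral_comp_id_comm IsGaussian.integrable_id]
    simp [hγ]
  have hvar : Var[innerSL ℝ w; γ] = (‖w‖ * s) ^ 2 := by
    have h := covarianceBilin_self (μ := γ) IsGaussian.memLp_two_id w
    rw [hγ, covarianceBilin_multivariateGaussian hpos] at h
    refine h.symm.trans ?_
    rw [Matrix.smul_mulVec, Matrix.one_mulVec, dotProduct_smul, mul_pow,
      EuclideanSpace.real_norm_sq_eq]
    simp [dotProduct, mul_comm, sq]
  refine HasLaw.comp (Y := innerSL ℝ w) ⟨by fun_prop, ?_⟩ hZ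
  rw [IsGaussian.map_eq_gaussianReal, hmean, hvar]

/-! ### Concentration of the SOMP metric -/

namespace SOMP

variable {m n K : ℕ}

lemma expectedMetric_eq_sum (Φ : Matrix (Fin m) (Fin n) ℝ) (X : Matrix (Fin n) (Fin K) ℝ)
    (σ : EuclideanSpace ℝ (Fin K)) (P : EuclideanSpace ℝ (Fin m) →L[ℝ] EuclideanSpace ℝ (Fin m))
    (j : Fin n) :
    expectedMetric Φ X σ P j = ∑ k, ∫ x, |x| ∂(gaussianReal
      (inner ℝ (atom Φ j) (cleanMeasurement Φ X k - P (cleanMeasurement Φ X k)))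
      (atomSigma Φ σ P j k ^ 2).toNNReal) := by
  have hlaw (k : Fin K) : HasLaw
      (fun g : EuclideanSpace ℝ (Fin K) ↦ beta Φ X P j k + atomSigma Φ σ P j k * g k)
      (gaussianReal (beta Φ X P j k) (atomSigma Φ σ P j k ^ 2).toNNReal)
      (stdGaussian (EuclideanSpace ℝ (Fin K))) := by
    have h0 : HasLaw (fun g : EuclideanSpace ℝ (Fin K) ↦ g k) (gaussianReal 0 1)
        (stdGaussian (EuclideanSpace ℝ (Fin K))) := by
      have h := measurePreserving_eval_multivariateGaussian
        (μ := (0 : EuclideanSpace ℝ (Fin K))) (Matrix.PosSemidef.one (n := Fin K) (R := ℝ)) (i := k)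
      rw [multivariateGaussian_zero_one] at h
      exact ⟨h.measurable.aemeasurable, by simpa using h.map_eq⟩
    have h1 := gaussianReal_const_add (gaussianReal_const_mul h0 (atomSigma Φ σ P j k))
      (beta Φ X P j k)
    convert h1 using 2
    · simp
    · ext; simp [sq_nonneg]
  have hint (k : Fin K) : Integrable
      (fun g : EuclideanSpace ℝ (Fin K) ↦ |beta Φ X P j k + atomSigma Φ σ P j k * g k|)
      (stdGaussian (EuclideanSpace ℝ (Fin K))) := by
    have h := (IsGaussian.integrable_fun_id (μ := gaussianReal (beta Φ X P j k)
      (atomSigma Φ σ P j k ^ 2).toNNReal))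
    rw [← (hlaw k).map_eq] at h
    exact (h.comp_aemeasurable (hlaw k).aemeasurable).abs
  simp only [expectedMetric, f]
  rw [integral_finsetSum _ fun k _ ↦ hint k]
  refine Finset.sum_congr rfl fun k _ ↦ ?_
  rw [← integral_abs_gaussianReal_abs]
  exact (hlaw k).integral_comp (f := fun x ↦ |x|) (by fun_prop)

/-- Each centred metric is sub-Gaussian with variance proxy `‖σ‖²`, as a sum of independent variables
`|Z_k| - 𝔼|Z_k|` with `Z_k` Gaussian of variance `σ_{j,k}² ≤ σ_k²`. -/
lemma hasSubgaussianMGF_metric_residual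
    {Φ : Matrix (Fin m) (Fin n) ℝ} (hΦ : ∀ j, ‖atom Φ j‖ = 1)
    (X : Matrix (Fin n) (Fin K) ℝ) {σ : EuclideanSpace ℝ (Fin K)}
    {Ω : Type*} [MeasurableSpace Ω] {μ : Measure Ω} [IsProbabilityMeasure μ]
    {e : Fin K → Ω → EuclideanSpace ℝ (Fin m)}
    (he_law : ∀ k, HasLaw (e k)
      (multivariateGaussian 0 (σ k ^ 2 • (1 : Matrix (Fin m) (Fin m) ℝ))) μ)
    (he_indep : iIndepFun e μ) (T : Finset (Fin n)) (j : Fin n) :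
    HasSubgaussianMGF (fun ω ↦
      metric Φ (residual (projector Φ T) fun k ↦ cleanMeasurement Φ X k + e k ω) j -
        expectedMetric Φ X σ (projector Φ T) j) (‖σ‖ ^ 2).toNNReal μ := by
  set P := projector Φ T with hP
  set U := Submodule.span ℝ (atom Φ '' (T : Set (Fin n))) with hU
  have hPU (u : EuclideanSpace ℝ (Fin m)) : u - P u = Uᗮ.starProjection u :=
    (U.starProjection_orthogonal_val u).symm
  set w := atom Φ j - P (atom Φ j) with hw
  have hw1 : ‖w‖ ≤ 1 := by
    rw [hw, hPU, ← hΦ j]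
    exact Submodule.norm_starProjection_apply_le _ _
  set c : Fin K → ℝ := fun k ↦
    inner ℝ (atom Φ j) (cleanMeasurement Φ X k - P (cleanMeasurement Φ X k)) with hc
  -- The projector `I - P` is symmetric, so in the noise term it can be moved onto the atom.
  have hsplit (k : Fin K) (ω : Ω) : inner ℝ (atom Φ j)
      (residual P (fun k ↦ cleanMeasurement Φ X k + e k ω) k) = c k + inner ℝ w (e k ω) := by
    simp only [residual, hc, hw, hPU]
    rw [map_add, inner_add_right,
      Submodule.inner_starProjection_left_eq_right]
  have hsub (k : Fin K) : HasSubgaussianMGF (fun ω ↦ |c k + inner ℝ w (e k ω)| -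
      ∫ x, |x| ∂(gaussianReal (c k) (atomSigma Φ σ P j k ^ 2).toNNReal))
      (σ k ^ 2).toNNReal μ := by
    have hlaw := gaussianReal_const_add (hasLaw_inner_multivariateGaussian (he_law k) w) (c k)
    rw [zero_add] at hlaw
    refine hasSubgaussianMGF_mono (hasSubgaussianMGF_abs_sub_integral hlaw)
      (Real.toNNReal_le_toNNReal ?_)
    rw [atomSigma, mul_pow]
    exact mul_le_of_le_one_left (sq_nonneg _) (pow_le_one₀ (norm_nonneg _) hw1)
  have hindep : iIndepFun (fun k ω ↦ |c k + inner ℝ w (e k ω)| -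
      ∫ x, |x| ∂(gaussianReal (c k) (atomSigma Φ σ P j k ^ 2).toNNReal)) μ :=
    he_indep.comp (fun k y ↦ |c k + inner ℝ w y| -
      ∫ x, |x| ∂(gaussianReal (c k) (atomSigma Φ σ P j k ^ 2).toNNReal)) (by fun_prop)
  have h := HasSubgaussianMGF.sum_of_iIndepFun hindep (s := Finset.univ) fun k _ ↦ hsub k
  rw [← Real.toNNReal_sum_of_nonneg fun k _ ↦ sq_nonneg (σ k), ← EuclideanSpace.real_norm_sq_eq]
    at h
  convert h using 2 with ω
  rw [Finset.sum_sub_distrib, expectedMetric_eq_sum, metric]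
  simp_rw [hsplit]
  rfl

end SOMP

/-! ### The probability of picking an incorrect atom -/

theorem theorem2 {m n K : ℕ}
    (Φ : Matrix (Fin m) (Fin n) ℝ) (hΦ : ∀ j, ‖SOMP.atom Φ j‖ = 1)
    (X : Matrix (Fin n) (Fin K) ℝ) (hS : (SOMP.jointSupport X)ᶜ.Nonempty)
    (σ : EuclideanSpace ℝ (Fin K)) (hσ : ∀ k, 0 ≤ σ k) (hσ_ne : σ ≠ 0)
    {Ω : Type*} [MeasurableSpace Ω] (μ : Measure Ω) [IsProbabilityMeasure μ]
    (e : Fin K → Ω → EuclideanSpace ℝ (Fin m))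
    (he_law : ∀ k, HasLaw (e k)
      (multivariateGaussian 0 (σ k ^ 2 • (1 : Matrix (Fin m) (Fin m) ℝ))) μ)
    (he_indep : iIndepFun e μ)
    (Y : Ω → Fin K → EuclideanSpace ℝ (Fin m))
    (hY : ∀ ω k, Y ω k = SOMP.cleanMeasurement Φ X k + e k ω)
    (t : ℕ) (P : EuclideanSpace ℝ (Fin m) →L[ℝ] EuclideanSpace ℝ (Fin m))
    (hP : P ∈ SOMP.projectors Φ (SOMP.jointSupport X) t)
    (jc : Fin n) (hjc : SOMP.IsBestCorrectAtom Φ X P jc)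
    (hΔ : 0 < SOMP.deltaE Φ X σ P jc hS)
    (pick : Ω → Fin n) (hpick : ∀ ω, SOMP.Picks Φ (SOMP.residual P (Y ω)) (pick ω)) :
    μ.real {ω | pick ω ∉ SOMP.jointSupport X} ≤
      ((n : ℝ) - (SOMP.jointSupport X).card + 1) *
        Real.exp (-(1 / (8 * ‖σ‖ ^ 2) * SOMP.deltaE Φ X σ P jc hS ^ 2)) := by
  obtain ⟨T, -, -, rfl⟩ := hP
  obtain rfl : Y = fun ω k ↦ SOMP.cleanMeasurement Φ X k + e k ω :=
    funext fun ω ↦ funext fun k ↦ hY ω k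
  set P := SOMP.projector Φ T
  set Δ := SOMP.deltaE Φ X σ P jc hS with hΔdef
  set S := SOMP.jointSupport X
  set E := SOMP.expectedMetric Φ X σ P with hE
  set Z : Fin n → Ω → ℝ := fun j ω ↦
    SOMP.metric Φ (SOMP.residual P fun k ↦ SOMP.cleanMeasurement Φ X k + e k ω) j - E j with hZ
  set q := Real.exp (-(1 / (8 * ‖σ‖ ^ 2) * Δ ^ 2)) with hq
  have hsub (j : Fin n) : HasSubgaussianMGF (Z j) (‖σ‖ ^ 2).toNNReal μ :=
    SOMP.hasSubgaussianMGF_metric_residual hΦ X he_law he_indep T j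
  have hexp : Real.exp (-(Δ / 2) ^ 2 / (2 * ((‖σ‖ ^ 2).toNNReal : ℝ))) = q := by
    rw [Real.coe_toNNReal _ (sq_nonneg _), hq]
    congr 1
    have : ‖σ‖ ≠ 0 := norm_ne_zero_iff.2 hσ_ne
    field_simp
    norm_num
  have hup (j : Fin n) : μ.real {ω | Δ / 2 ≤ Z j ω} ≤ q :=
    ((hsub j).measure_ge_le (half_pos hΔ).le).trans_eq hexp
  have hlow : μ.real {ω | Δ / 2 ≤ (-Z jc) ω} ≤ q :=
    ((hsub jc).neg.measure_ge_le (half_pos hΔ).le).trans_eq hexp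
  have hincl : {ω | pick ω ∉ S} ⊆
      (⋃ j ∈ Sᶜ, {ω | Δ / 2 ≤ Z j ω}) ∪ {ω | Δ / 2 ≤ (-Z jc) ω} := by
    intro ω hω
    by_contra hcon
    simp only [Set.mem_union, Set.mem_iUnion, Set.mem_ofPred_eq, not_or, not_exists, not_le,
      Pi.neg_apply] at hcon
    have hmem : pick ω ∈ Sᶜ := Finset.mem_compl.2 hω
    have h1 := hcon.1 (pick ω) hmem
    have h2 := hcon.2
    have h3 := hpick ω jc
    have h4 : E (pick ω) ≤ Sᶜ.sup' hS E := Finset.le_sup' E hmem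
    have h5 : Δ = E jc - Sᶜ.sup' hS E := rfl
    simp only [hZ] at h1 h2
    linarith
  calc μ.real {ω | pick ω ∉ S}
      ≤ μ.real ((⋃ j ∈ Sᶜ, {ω | Δ / 2 ≤ Z j ω}) ∪ {ω | Δ / 2 ≤ (-Z jc) ω}) :=
        measureReal_mono hincl
    _ ≤ ∑ j ∈ Sᶜ, μ.real {ω | Δ / 2 ≤ Z j ω} + μ.real {ω | Δ / 2 ≤ (-Z jc) ω} :=
        (measureReal_union_le _ _).trans
          (add_le_add_left (measureReal_biUnion_finset_le _ _) _)
    _ ≤ ∑ _j ∈ Sᶜ, q + q := add_le_add (Finset.sum_le_sum fun j _ ↦ hup j) hlow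
    _ = ((n : ℝ) - S.card + 1) * q := by
        rw [Finset.sum_const, nsmul_eq_mul, Finset.card_compl, Fintype.card_fin,
          Nat.cast_sub (by simpa using S.card_le_univ)]
        ring
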